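/- Let $X$ be a smooth variety over a field and let $\Delta=\sum_{i} D_i$ be a simple normal crossing divisor on $X$ with finitely many irreducible components $D_i$; that is, every point $p\in X$ has a neighbourhood with local coordinates $x_1,\dots,x_n$ at $p$ (a regular system of parameters of $\mathcal O_{X,p}$) such that the $D_i$ passing through $p$ are defined near $p$ by pairwise different coordinates. A \emph{stratum} of $(X,\Delta)$ is an irreducible component of an intersection $D_{i_1}\cap\dots\cap D_{i_r}$, $r\ge 0$ (so $X$, the empty intersection, is a stratum). A quasi-coherent ideal sheaf $I\subset\mathcal O_X$ is \emph{toroidal} if $X$ is covered by open sets $U$ such that $I|_U=\sum_{s}\mathcal O_U\bigl(-\sum_i m_{is}D_i|_U\bigr)$ for a (possibly empty) family of vectors of natural numbers $(m_{is})_i$. For a quasi-coherent ideal sheaf $J\subset\mathcal O_X$ let $J^t$ be its \emph{toroidal hull}, i.e. the infimum, among quasi-coherent ideal sheaves, of all toroidal ideal sheaves containing $J$ (it coincides with the smallest toroidal ideal sheaf containing $J$). Then $J$ is \emph{toroidally resolved}, meaning that its cosupport $\operatorname{Supp}(\mathcal O_X/J)$ does not contain any stratum of $(X,\Delta)$, if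 and only if $J^t=\mathcal O_X$. -/

import Mathlib

open AlgebraicGeometry CategoryTheory

universe u

namespace Toroidal

/-- A smooth variety over the field `k`: an integral, separated, quasi-compact scheme that is
smooth (in particular locally of finite type) over `k`. -/
structure IsSmoothVariety {k : Type u} [Field k] {X : Scheme.{u}}
    (f : X ⟶ Spec (CommRingCat.of k)) : Prop where
  isIntegral : IsIntegral X
  isSeparated : IsSeparated f
  quasiCompact : QuasiCompact f
  smooth : Smooth f

/-- `x₁, …, xₙ` are local coordinates (a regular system of parameters) of the ring `R`:
`R` is a regular local ring of dimension `n` and the `xⱼ` generate its maximal ideal. -/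
def IsLocalCoordinates (R : Type*) [CommRing R] {n : ℕ} (x : Fin n → R) : Prop :=
  ∃ _ : IsRegularLocalRing R,
    ringKrullDim R = n ∧ Ideal.span (Set.range x) = IsLocalRing.maximalIdeal R

/-- `∑ᵢ Dᵢ` is a simple normal crossing divisor on `X`. The divisor `Dᵢ` is given by its ideal sheaf
`D i = 𝒪_X(-Dᵢ)`. Every `Dᵢ` is irreducible, and every point `p` has an affine open neighbourhood
with sections `x₁, …, xₙ` that are local coordinates at `p`, such that the `Dᵢ` passing through `p`
are defined there by pairwise different coordinates. -/
structure IsSNC {X : Scheme.{u}} {ι : Type*} (D : ι → X.IdealSheafData) : Prop where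
  irreducible : ∀ i, IsIrreducible ((D i).support : Set X)
  exists_coordinates : ∀ p : X, ∃ (U : X.affineOpens) (hp : p ∈ U.1) (n : ℕ)
    (x : Fin n → Γ(X, U.1)) (c : {i : ι // p ∈ (D i).support} → Fin n),
    IsLocalCoordinates (X.presheaf.stalk p) (fun j => (X.presheaf.germ U.1 p hp).hom (x j)) ∧
    Function.Injective c ∧
    ∀ i : {i : ι // p ∈ (D i).support}, (D i.1).ideal U = Ideal.span {x (c i)}

/-- A (closed) stratum of `(X, ∑ Dᵢ)`: an irreducible component of an intersection
`D_{i₁} ∩ ⋯ ∩ D_{iᵣ}`. The empty intersection is `X`. -/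
def IsStratum {X : Scheme.{u}} {ι : Type*} (D : ι → X.IdealSheafData) (Z : Set X) : Prop :=
  ∃ S : Finset ι,
    Maximal (fun W : Set X => IsIrreducible W ∧ W ⊆ ⋂ i ∈ S, ((D i).support : Set X)) Z

/-- `J` is toroidally resolved: its cosupport (the support of `𝒪_X / J`) contains no stratum. -/
def IsToroidallyResolved {X : Scheme.{u}} {ι : Type*} (D : ι → X.IdealSheafData)
    (J : X.IdealSheafData) : Prop :=
  ∀ Z : Set X, IsStratum D Z → ¬ Z ⊆ (J.support : Set X)

/-- The ideal sheaf `𝒪_X(-∑ mᵢ Dᵢ)`. -/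
noncomputable def monomialIdeal {X : Scheme.{u}} {ι : Type*} [Fintype ι]
    (D : ι → X.IdealSheafData) (m : ι → ℕ) : X.IdealSheafData :=
  ∏ i, D i ^ m i

/-- `I` is toroidal: `X` is covered by (affine) open sets `U` on which
`I = ∑ₛ 𝒪_U(-∑ᵢ m_{is} Dᵢ)` for a family `A` of exponent vectors. The family may be empty, so that
the zero ideal sheaf is toroidal. -/
def IsToroidal {X : Scheme.{u}} {ι : Type*} [Fintype ι] (D : ι → X.IdealSheafData)
    (I : X.IdealSheafData) : Prop :=
  ∀ p : X, ∃ U : X.affineOpens, p ∈ U.1 ∧ ∃ A : Set (ι → ℕ),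
    I.ideal U = (⨆ m ∈ A, monomialIdeal D m).ideal U

/-- The toroidal hull `Jᵗ`: the infimum, in the complete lattice of quasi-coherent ideal sheaves, of
all toroidal ideal sheaves that contain `J`. A smallest toroidal ideal sheaf containing `J` is
equal to it, see `toroidalHull_eq_of_isLeast`. -/
noncomputable def toroidalHull {X : Scheme.{u}} {ι : Type*} [Fintype ι]
    (D : ι → X.IdealSheafData) (J : X.IdealSheafData) : X.IdealSheafData :=
  sInf {I | IsToroidal D I ∧ J ≤ I}

theorem toroidalHull_eq_of_isLeast {X : Scheme.{u}} {ι : Type*} [Fintype ι]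
    {D : ι → X.IdealSheafData} {J Jt : X.IdealSheafData}
    (h : IsLeast {I | IsToroidal D I ∧ J ≤ I} Jt) : toroidalHull D J = Jt :=
  h.isGLB.sInf_eq

end Toroidal

/-! Two facts carry the proof. If `I` is toroidal and `p` lies in its cosupport, every monomial in a
presentation of `I` near `p` involves some `D i` through `p`, so it vanishes on a stratum `Z`
through `p` inside all these `D i`; as `Z` is irreducible, the cosupport contains `Z`
(`IsToroidal.exists_isStratum_subset_support`). So if `J` is resolved, a toroidal `I ≥ J` has empty
cosupport. Conversely, the vanishing ideal of a stratum `Z` is itself toroidal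
(`IsSNC.isToroidal_vanishingIdeal`): near a point of `Z` it is the sum of the `D i` cutting out `Z`,
because part of a regular system of parameters generates a prime ideal. If `Z` lies in the cosupport
of `J`, this proper ideal contains the hull. -/

/-! ### Commutative algebra: parts of a regular system of parameters generate primes. -/

open IsLocalRing in
theorem IsLocalRing.span_image_mk_and_card_le {R : Type*} [CommRing R] [IsLocalRing R]
    [IsNoetherianRing R] [DecidableEq R] (u v : Finset R)
    (h : Ideal.span (u ∪ v : Set R) = maximalIdeal R)
    (hd : ((u.card + v.card : ℕ) : WithBot ℕ∞) ≤ ringKrullDim R) :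
    ∃ _ : IsLocalRing (R ⧸ Ideal.span (u : Set R)),
      Ideal.span (Ideal.Quotient.mk (Ideal.span (u : Set R)) '' v) = maximalIdeal _ ∧
      (v.card : WithBot ℕ∞) ≤ ringKrullDim (R ⧸ Ideal.span (u : Set R)) := by
  have hu : Ideal.span (u : Set R) ≤ maximalIdeal R :=
    h ▸ Ideal.span_mono Set.subset_union_left
  have hne : Ideal.span (u : Set R) ≠ ⊤ := fun he =>
    (maximalIdeal.isMaximal R).ne_top (top_le_iff.mp (he ▸ hu))
  have := Ideal.Quotient.nontrivial_iff.mpr hne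
  have hloc : IsLocalRing (R ⧸ Ideal.span (u : Set R)) :=
    .of_surjective' (Ideal.Quotient.mk _) Ideal.Quotient.mk_surjective
  refine ⟨hloc, ?_, ?_⟩
  · rw [← IsLocalRing.map_maximalIdeal_of_surjective _ Ideal.Quotient.mk_surjective, ← h,
      Ideal.span_union, Ideal.map_sup, Ideal.map_quotient_self, bot_sup_eq, Ideal.map_span]
  -- Dividing by `u`, which lies in the Jacobson radical, lowers the dimension by at most `u.card`.
  · have h1 := ringKrullDim_le_ringKrullDim_quotient_add_card u
      (fun x hx => Ideal.jacobson_bot (R := R) ▸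
        IsLocalRing.maximalIdeal_le_jacobson ⊥ (hu (Ideal.subset_span hx)))
    have h2 := hd.trans h1
    rw [add_comm u.card, Nat.cast_add] at h2
    exact ENat.WithBot.add_le_add_natCast_right_iff.mp h2

-- Exchange argument: as `x` is outside the square of the maximal ideal, one of its coefficients on
-- `v` is a unit, and that generator can be traded for `x`.
open IsLocalRing in
theorem IsLocalRing.exists_finset_span_insert_eq {R : Type*} [CommRing R] [IsLocalRing R]
    [DecidableEq R] (v : Finset R) (h : Ideal.span (v : Set R) = maximalIdeal R) {x : R}
    (hx : x ∈ maximalIdeal R) (hx2 : x ∉ maximalIdeal R ^ 2) :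
    ∃ w : Finset R, w.card + 1 = v.card ∧ Ideal.span ({x} ∪ w : Set R) = maximalIdeal R := by
  obtain ⟨f, -, hf⟩ := Submodule.mem_span_finset.mp (h ▸ hx : x ∈ Ideal.span (v : Set R))
  obtain ⟨a, ha, hfa⟩ : ∃ a ∈ v, f a ∉ maximalIdeal R := by
    by_contra! hcon
    refine hx2 (hf ▸ Ideal.sum_mem _ fun a ha => ?_)
    rw [smul_eq_mul, pow_two]
    exact Ideal.mul_mem_mul (hcon a ha) (h ▸ Ideal.subset_span ha)
  obtain ⟨b, hb⟩ := (notMem_maximalIdeal.mp hfa).exists_left_inv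
  refine ⟨v.erase a, Finset.card_erase_add_one ha, le_antisymm ?_ ?_⟩
  · rw [Ideal.span_le]
    rintro y (rfl | hy)
    · exact hx
    · exact h ▸ Ideal.subset_span (Finset.mem_of_mem_erase hy)
  · rw [← h, Ideal.span_le]
    intro y hy
    have hw : ∀ z ∈ v.erase a, z ∈ Ideal.span ({x} ∪ (v.erase a : Finset R) : Set R) :=
      fun z hz => Ideal.subset_span (Or.inr hz)
    by_cases hya : y = a
    · rw [← Finset.add_sum_erase _ _ ha] at hf
      have hmem : b * (x - ∑ z ∈ v.erase a, f z • z) ∈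
          Ideal.span ({x} ∪ (v.erase a : Finset R) : Set R) :=
        Ideal.mul_mem_left _ _ (Ideal.sub_mem _ (Ideal.subset_span (Or.inl rfl))
          (Ideal.sum_mem _ fun z hz => Ideal.mul_mem_left _ _ (hw z hz)))
      rw [sub_eq_of_eq_add hf.symm, smul_eq_mul, ← mul_assoc, hb, one_mul] at hmem
      rwa [hya]
    · exact hw y (Finset.mem_erase.mpr ⟨hya, hy⟩)

open IsLocalRing in
/-- A noetherian local ring of positive dimension has an element of the maximal ideal that lies
neither in its square nor in a minimal prime. -/
theorem IsLocalRing.exists_mem_maximalIdeal_notMem_sq_notMem_minimalPrimes {R : Type*} [CommRing R]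
    [IsLocalRing R] [IsNoetherianRing R] (hd : 0 < ringKrullDim R) :
    ∃ x ∈ maximalIdeal R, x ∉ maximalIdeal R ^ 2 ∧ ∀ p ∈ minimalPrimes R, x ∉ p := by
  classical
  have hmin : maximalIdeal R ∉ minimalPrimes R := by
    rw [← Ideal.height_eq_zero_iff]
    intro h0
    rw [← maximalIdeal_height_eq_ringKrullDim, h0] at hd
    exact lt_irrefl _ hd
  have hfin := minimalPrimes.finite_of_isNoetherianRing R
  by_contra! hcon
  have hsub : (maximalIdeal R : Set R) ⊆
      ⋃ i ∈ ((insert (maximalIdeal R ^ 2) hfin.toFinset : Finset (Ideal R)) : Set (Ideal R)),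
        (id i : Ideal R) := by
    intro x hx
    simp only [Set.mem_iUnion, Finset.coe_insert, Set.mem_insert_iff, id]
    by_cases hx2 : x ∈ maximalIdeal R ^ 2
    · exact ⟨_, Or.inl rfl, hx2⟩
    · obtain ⟨p, hp, hxp⟩ := hcon x hx hx2
      exact ⟨p, Or.inr (by simpa using hp), hxp⟩
  -- Prime avoidance tolerates two non-prime ideals; the square fills both slots.
  obtain ⟨i, hi, hle⟩ := (Ideal.subset_union_prime (maximalIdeal R ^ 2) (maximalIdeal R ^ 2)
    (fun i hi h1 _ => by
      rcases Finset.mem_insert.mp hi with h | h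
      · exact (h1 h).elim
      · exact ((hfin.mem_toFinset).mp h).1.1)).mp hsub
  rcases Finset.mem_insert.mp hi with rfl | hi
  · have hbot : maximalIdeal R = ⊥ :=
      Submodule.eq_bot_of_le_smul_of_le_jacobson_bot (maximalIdeal R) _
        (IsNoetherian.noetherian _) (by simpa [pow_two] using hle) (maximalIdeal_le_jacobson _)
    refine hmin ⟨⟨inferInstance, bot_le⟩, fun q _ _ => hbot ▸ bot_le⟩
  · have hp := (hfin.mem_toFinset).mp hi
    have := hp.1.1
    have he : maximalIdeal R = i := le_antisymm hle (le_maximalIdeal hp.1.1.ne_top)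
    exact hmin (he ▸ hp)

open IsLocalRing in
/-- A noetherian local ring whose maximal ideal is generated by at most `dim R` elements is a
domain. -/
theorem IsLocalRing.isDomain_of_span_eq_maximalIdeal (N : ℕ) {R : Type*} [CommRing R]
    [IsLocalRing R] [IsNoetherianRing R] (v : Finset R) (hN : v.card ≤ N)
    (h : Ideal.span (v : Set R) = maximalIdeal R)
    (hd : (v.card : WithBot ℕ∞) ≤ ringKrullDim R) : IsDomain R := by
  classical
  -- Induction on a bound, since generators may a priori become equal in the quotient.
  induction N generalizing R with
  | zero =>
    rw [Nat.le_zero, Finset.card_eq_zero] at hN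
    subst hN
    rw [Finset.coe_empty, Ideal.span_empty] at h
    exact (isField_iff_maximalIdeal_eq.mpr h.symm).isDomain
  | succ N ih =>
    rcases Nat.eq_zero_or_pos v.card with h0 | h0
    · rw [Finset.card_eq_zero] at h0
      subst h0
      rw [Finset.coe_empty, Ideal.span_empty] at h
      exact (isField_iff_maximalIdeal_eq.mpr h.symm).isDomain
    obtain ⟨x, hx, hx2, hxp⟩ := exists_mem_maximalIdeal_notMem_sq_notMem_minimalPrimes
      (R := R) (lt_of_lt_of_le (by exact_mod_cast h0) hd)
    obtain ⟨w, hw, hspan⟩ := exists_finset_span_insert_eq v h hx hx2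
    obtain ⟨_, hspan', hd'⟩ := span_image_mk_and_card_le {x} w (by simpa using hspan)
      (by rwa [Finset.card_singleton, add_comm, hw])
    have hle : (w.image (Ideal.Quotient.mk (Ideal.span (({x} : Finset R) : Set R)))).card ≤ w.card :=
      Finset.card_image_le
    have hdom := ih (w.image (Ideal.Quotient.mk (Ideal.span (({x} : Finset R) : Set R))))
      (by omega) (by rwa [Finset.coe_image]) (le_trans (by exact_mod_cast hle) hd')
    rw [Ideal.Quotient.isDomain_iff_prime, Finset.coe_singleton] at hdom
    -- By induction `(x)` is prime, so it contains a minimal prime `p`. As `x ∉ p`, every `x * z ∈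
    -- p` has `z ∈ p`, so `p = x p` and Nakayama gives `p = 0`.
    obtain ⟨p, hp, hpx⟩ := Ideal.exists_minimalPrimes_le (I := ⊥) (J := Ideal.span {x}) bot_le
    have hpp : p.IsPrime := hp.1.1
    have hbot : p = ⊥ := by
      refine Submodule.eq_bot_of_le_smul_of_le_jacobson_bot (maximalIdeal R) _
        (IsNoetherian.noetherian _) (fun y hy => ?_) (maximalIdeal_le_jacobson _)
      obtain ⟨z, rfl⟩ := Ideal.mem_span_singleton.mp (hpx hy)
      exact Ideal.mul_mem_mul hx ((hpp.mem_or_mem hy).resolve_left (hxp p hp))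
    subst hbot
    exact IsDomain.of_bot_isPrime R

-- Modulo the coordinates in `T`, the remaining ones generate the maximal ideal and number at most
-- the dimension, so the quotient is a domain.
open IsLocalRing in
theorem IsLocalRing.isPrime_span_image {R : Type*} [CommRing R] [IsLocalRing R]
    [IsNoetherianRing R] {n : ℕ} {x : Fin n → R}
    (h : Ideal.span (Set.range x) = maximalIdeal R) (hd : (n : WithBot ℕ∞) ≤ ringKrullDim R)
    (T : Finset (Fin n)) : (Ideal.span (x '' T)).IsPrime := by
  classical
  have hu : (T.image x).card ≤ T.card := Finset.card_image_le
  have hv : (Tᶜ.image x).card ≤ Tᶜ.card := Finset.card_image_le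
  have hT := T.card_add_card_compl
  rw [Fintype.card_fin] at hT
  obtain ⟨_, hspan, hd'⟩ := span_image_mk_and_card_le (T.image x) (Tᶜ.image x)
    (by rw [Finset.coe_image, Finset.coe_image, ← Set.image_union, ← Finset.coe_union,
      Finset.union_compl, Finset.coe_univ, Set.image_univ, h])
    (le_trans (by exact_mod_cast (by omega)) hd)
  have hle : ((Tᶜ.image x).image
      (Ideal.Quotient.mk (Ideal.span ((T.image x : Finset R) : Set R)))).card ≤ (Tᶜ.image x).card :=
    Finset.card_image_le
  have := isDomain_of_span_eq_maximalIdeal _ ((Tᶜ.image x).image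
      (Ideal.Quotient.mk (Ideal.span ((T.image x : Finset R) : Set R)))) le_rfl
    ((congrArg Ideal.span Finset.coe_image).trans hspan) (le_trans (by exact_mod_cast hle) hd')
  rwa [Ideal.Quotient.isDomain_iff_prime, Finset.coe_image] at this

/-! ### Passing between a stalk and a neighbourhood. -/

namespace AlgebraicGeometry.Scheme

variable {X : Scheme.{u}}

theorem fromSpecStalk_mem {U : X.Opens} {p : X} (hp : p ∈ U) (y : Spec (X.presheaf.stalk p)) :
    X.fromSpecStalk p y ∈ U := by
  have h : X.fromSpecStalk p y ∈ Set.range (X.fromSpecStalk p) := ⟨y, rfl⟩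
  rw [range_fromSpecStalk] at h
  exact h.mem_open U.2 hp

theorem fromSpecStalk_mem_basicOpen_iff {U : X.Opens} (hU : IsAffineOpen U) {p : X} (hp : p ∈ U)
    (f : Γ(X, U)) (y : Spec (X.presheaf.stalk p)) :
    X.fromSpecStalk p y ∈ X.basicOpen f ↔ (X.presheaf.germ U p hp).hom f ∉ y.asIdeal := by
  rw [← hU.fromSpecStalk_eq_fromSpecStalk hp, IsAffineOpen.fromSpecStalk, Hom.comp_apply]
  change _ ∈ hU.fromSpec ⁻¹ᵁ X.basicOpen f ↔ _
  rw [hU.fromSpec_preimage_basicOpen]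
  rfl

theorem fromSpecStalk_mem_support_iff (K : X.IdealSheafData) (U : X.affineOpens) {p : X}
    (hp : p ∈ U.1) (y : Spec (X.presheaf.stalk p)) :
    X.fromSpecStalk p y ∈ K.support ↔
      (K.ideal U).map (X.presheaf.germ U.1 p hp).hom ≤ y.asIdeal := by
  rw [IdealSheafData.mem_support_iff_of_mem (fromSpecStalk_mem hp y), mem_zeroLocus_iff,
    Ideal.map_le_iff_le_comap]
  refine forall₂_congr fun f _ => ?_
  rw [fromSpecStalk_mem_basicOpen_iff U.2 hp, not_not]
  rfl

/-- Each of finitely many generators needs one denominator; `a` is their product. -/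
theorem exists_map_basicOpen_le {U : X.Opens} (hU : IsAffineOpen U) {p : X} (hp : p ∈ U)
    {I K : Ideal Γ(X, U)} (hI : I.FG)
    (h : I.map (X.presheaf.germ U p hp).hom ≤ K.map (X.presheaf.germ U p hp).hom) :
    ∃ a : Γ(X, U), p ∈ X.basicOpen a ∧
      I.map (X.presheaf.map (homOfLE <| X.basicOpen_le a).op).hom ≤
        K.map (X.presheaf.map (homOfLE <| X.basicOpen_le a).op).hom := by
  let := X.presheaf.algebra_section_stalk ⟨p, hp⟩
  have hloc := hU.isLocalization_stalk ⟨p, hp⟩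
  have key : ∀ g ∈ I, ∃ a : Γ(X, U), p ∈ X.basicOpen a ∧ a * g ∈ K := by
    intro g hg
    have := h (Ideal.mem_map_of_mem _ hg)
    change algebraMap Γ(X, U) (X.presheaf.stalk p) g ∈ K.map (algebraMap _ _) at this
    rw [IsLocalization.algebraMap_mem_map_algebraMap_iff
      (hU.primeIdealOf ⟨p, hp⟩).asIdeal.primeCompl] at this
    obtain ⟨a, ha, hag⟩ := this
    refine ⟨a, ?_, hag⟩
    rw [X.mem_basicOpen _ _ hp]
    exact IsLocalization.map_units (M := (hU.primeIdealOf ⟨p, hp⟩).asIdeal.primeCompl)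
      (X.presheaf.stalk p) ⟨a, ha⟩
  obtain ⟨t, rfl⟩ := hI
  choose! a ha hag using fun g (hg : g ∈ t) => key g (Ideal.subset_span hg)
  refine ⟨∏ g ∈ t, a g, ?_, ?_⟩
  · rw [X.mem_basicOpen _ _ hp, map_prod, IsUnit.prod_iff]
    exact fun g hg => (X.mem_basicOpen _ _ hp).mp (ha g hg)
  · rw [Ideal.map_span, Ideal.span_le]
    rintro _ ⟨g, hg, rfl⟩
    have hunit : IsUnit ((X.presheaf.map (homOfLE <| X.basicOpen_le (∏ g ∈ t, a g)).op).hom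
        (∏ g ∈ t, a g)) := RingedSpace.isUnit_res_basicOpen _ _
    refine (Ideal.unit_mul_mem_iff_mem _ hunit).mp ?_
    rw [← map_mul]
    refine Ideal.mem_map_of_mem _ ?_
    obtain ⟨c, hc⟩ := Finset.dvd_prod_of_mem a hg
    rw [hc, mul_comm (a g), mul_assoc]
    exact Ideal.mul_mem_left _ _ (hag g hg)

/-- If `Z` is an irreducible component of the support of `K` and `K` is prime at `p ∈ Z`, then `K`
is the vanishing ideal of `Z` at `p`. -/
theorem map_germ_vanishingIdeal_le {K : X.IdealSheafData} {Z : TopologicalSpace.Closeds X}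
    (hZ : Maximal (fun W : Set X => IsIrreducible W ∧ W ⊆ (K.support : Set X)) Z)
    (U : X.affineOpens) {p : X} (hp : p ∈ U.1) (hpZ : p ∈ Z)
    (hK : ((K.ideal U).map (X.presheaf.germ U.1 p hp).hom).IsPrime) :
    ((IdealSheafData.vanishingIdeal Z).ideal U).map (X.presheaf.germ U.1 p hp).hom ≤
      (K.ideal U).map (X.presheaf.germ U.1 p hp).hom := by
  obtain ⟨w, hw⟩ := QuasiSober.sober hZ.prop.1 Z.isClosed
  have hwp : w ⤳ p := specializes_iff_mem_closure.mpr (hw.symm ▸ hpZ)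
  have hw' : w ∈ Set.range (X.fromSpecStalk p) := by rwa [range_fromSpecStalk]
  obtain ⟨y, rfl⟩ := hw'
  -- The prime `K` at `p` gives a point `y₀` specializing to the generic point `y` of `Z`;
  -- maximality of `Z` puts `y₀` in `Z`.
  let y₀ : Spec (X.presheaf.stalk p) := ⟨_, hK⟩
  have hwK : X.fromSpecStalk p y ∈ K.support := hZ.prop.2 hw.mem
  rw [fromSpecStalk_mem_support_iff K U hp] at hwK
  have hspec : X.fromSpecStalk p y₀ ⤳ X.fromSpecStalk p y :=
    ((PrimeSpectrum.le_iff_specializes y₀ y).mp hwK).map (X.fromSpecStalk p).continuous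
  have hle : (Z : Set X) ⊆ closure {X.fromSpecStalk p y₀} := by
    rw [← hw.def]
    exact hspec.closure_subset
  have hmem : X.fromSpecStalk p y₀ ∈ K.support :=
    (fromSpecStalk_mem_support_iff K U hp y₀).mpr le_rfl
  have hy₀ : X.fromSpecStalk p y₀ ∈ Z := hZ.le_of_ge
    ⟨isIrreducible_singleton.closure, closure_minimal (by simpa using hmem) K.support.isClosed⟩
    hle (subset_closure rfl)
  rw [← SetLike.mem_coe, ← IdealSheafData.coe_support_vanishingIdeal] at hy₀
  exact (fromSpecStalk_mem_support_iff _ U hp y₀).mp hy₀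

end AlgebraicGeometry.Scheme

theorem IsChain.isPreirreducible_sUnion {T : Type*} [TopologicalSpace T] {c : Set (Set T)}
    (hc : IsChain (· ⊆ ·) c) (h : ∀ W ∈ c, IsPreirreducible W) : IsPreirreducible (⋃₀ c) := by
  rintro u v hu hv ⟨y, ⟨W, hW, hy⟩, hyu⟩ ⟨x, ⟨W', hW', hx⟩, hxv⟩
  obtain ⟨V, hV, hyV, hxV⟩ : ∃ V ∈ c, y ∈ V ∧ x ∈ V := by
    rcases hc.total hW hW' with hle | hle
    · exact ⟨W', hW', hle hy, hx⟩
    · exact ⟨W, hW, hy, hle hx⟩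
  obtain ⟨z, hz, hzuv⟩ := h V hV u v hu hv ⟨y, hyV, hyu⟩ ⟨x, hxV, hxv⟩
  exact ⟨z, ⟨V, hV, hz⟩, hzuv⟩

/-! ### Strata and toroidal ideal sheaves. -/

namespace Toroidal

variable {X : Scheme.{u}} {ι : Type*}

theorem isClosed_of_isStratum {D : ι → X.IdealSheafData} {Z : Set X} (hZ : IsStratum D Z) :
    IsClosed Z := by
  obtain ⟨S, hS⟩ := hZ
  have hcl : IsClosed (⋂ i ∈ S, ((D i).support : Set X)) :=
    isClosed_biInter fun i _ => (D i).support.isClosed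
  exact isClosed_of_closure_subset
    (hS.le_of_ge ⟨hS.prop.1.closure, closure_minimal hS.prop.2 hcl⟩ subset_closure)

theorem coe_support_biSup (D : ι → X.IdealSheafData) (S : Finset ι) :
    ((⨆ i ∈ S, D i).support : Set X) = ⋂ i ∈ S, ((D i).support : Set X) := by
  simp only [Scheme.IdealSheafData.support_iSup, TopologicalSpace.Closeds.coe_iInf]

theorem exists_isStratum_of_forall_mem_support (D : ι → X.IdealSheafData) (S : Finset ι) {p : X}
    (hp : ∀ i ∈ S, p ∈ (D i).support) :
    ∃ Z : Set X, IsStratum D Z ∧ p ∈ Z ∧ Z ⊆ ⋂ i ∈ S, ((D i).support : Set X) := by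
  obtain ⟨Z, hpZ, hZ⟩ := zorn_subset_nonempty
    {W : Set X | IsIrreducible W ∧ W ⊆ ⋂ i ∈ S, ((D i).support : Set X)}
    (fun c hc hcc hne => ⟨⋃₀ c, ⟨⟨
        hne.elim fun W hW => (hc hW).1.1.mono (Set.subset_sUnion_of_mem hW),
        IsChain.isPreirreducible_sUnion hcc fun W hW => (hc hW).1.2⟩,
        Set.sUnion_subset fun W hW => (hc hW).2⟩, fun W hW => Set.subset_sUnion_of_mem hW⟩) {p}
    ⟨isIrreducible_singleton, by simpa using hp⟩
  exact ⟨Z, ⟨S, hZ⟩, hpZ rfl, hZ.prop.2⟩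

variable [Fintype ι]

theorem monomialIdeal_zero (D : ι → X.IdealSheafData) : monomialIdeal D 0 = ⊤ := by
  rw [← Scheme.IdealSheafData.one_eq_top]
  simp only [monomialIdeal, Pi.zero_apply, pow_zero, Finset.prod_const_one]

theorem monomialIdeal_single [DecidableEq ι] (D : ι → X.IdealSheafData) (i : ι) :
    monomialIdeal D (Pi.single i 1) = D i := by
  rw [monomialIdeal, Finset.prod_eq_single i (fun j _ hj => by simp [hj])
    (fun h => (h (Finset.mem_univ i)).elim), Pi.single_eq_same, pow_one]

theorem monomialIdeal_le (D : ι → X.IdealSheafData) {m : ι → ℕ} {i : ι} (hi : m i ≠ 0) :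
    monomialIdeal D m ≤ D i := by
  classical
  intro U
  rw [monomialIdeal, ← Finset.mul_prod_erase _ _ (Finset.mem_univ i)]
  exact (Ideal.mul_le_left (I := (D i).ideal U ^ m i)).trans (Ideal.pow_le_self hi)

theorem exists_mem_support_of_mem_support_monomialIdeal (D : ι → X.IdealSheafData) {m : ι → ℕ}
    {p : X} (hp : p ∈ (monomialIdeal D m).support) : ∃ i, m i ≠ 0 ∧ p ∈ (D i).support := by
  classical
  by_contra! hcon
  rw [monomialIdeal] at hp
  have : ∀ s : Finset ι, p ∉ (∏ i ∈ s, D i ^ m i).support := by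
    intro s
    induction s using Finset.induction_on with
    | empty =>
      rw [Finset.prod_empty, Scheme.IdealSheafData.one_eq_top, Scheme.IdealSheafData.support_top]
      exact Set.notMem_empty p
    | insert i s hi ih =>
      rw [Finset.prod_insert hi, Scheme.IdealSheafData.support_mul]
      rintro (h | h)
      · by_cases h0 : m i = 0
        · simp [h0] at h
        · exact hcon i h0 (Scheme.IdealSheafData.support_pow _ _ h0 ▸ h)
      · exact ih h
  exact this _ hp

/-- The support of a toroidal ideal sheaf contains a stratum through each of its points. -/
theorem IsToroidal.exists_isStratum_subset_support {D : ι → X.IdealSheafData}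
    {I : X.IdealSheafData} (hI : IsToroidal D I) {p : X} (hp : p ∈ I.support) :
    ∃ Z : Set X, IsStratum D Z ∧ Z ⊆ (I.support : Set X) := by
  classical
  obtain ⟨Z, hZ, hpZ, hZS⟩ := exists_isStratum_of_forall_mem_support D
    (Finset.univ.filter fun i => p ∈ (D i).support) (p := p) (by simp)
  refine ⟨Z, hZ, ?_⟩
  obtain ⟨U, hpU, A, hA⟩ := hI p
  have hsupp : ∀ q ∈ U.1, q ∈ I.support ↔ ∀ m ∈ A, q ∈ (monomialIdeal D m).support := by
    intro q hq
    rw [Scheme.IdealSheafData.mem_support_iff_of_mem hq, hA,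
      ← Scheme.IdealSheafData.mem_support_iff_of_mem hq, ← SetLike.mem_coe]
    simp only [Scheme.IdealSheafData.support_iSup, TopologicalSpace.Closeds.coe_iInf,
      Set.mem_iInter, SetLike.mem_coe]
  have hZU : Z ∩ U.1 ⊆ (I.support : Set X) := by
    rintro q ⟨hqZ, hqU⟩
    refine (hsupp q hqU).mpr fun m hm => ?_
    obtain ⟨i, hmi, hpi⟩ :=
      exists_mem_support_of_mem_support_monomialIdeal D ((hsupp p hpU).mp hp m hm)
    have hqi : q ∈ ((D i).support : Set X) :=
      Set.mem_iInter₂.mp (hZS hqZ) i (by simpa using hpi)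
    exact Scheme.IdealSheafData.support_antitone (monomialIdeal_le D hmi) hqi
  obtain ⟨S, hS⟩ := hZ
  -- `Z ∩ U` is dense in `Z`, so the local containment is global.
  exact (subset_closure_inter_of_isPreirreducible_of_isOpen hS.prop.1.2 U.1.2 ⟨p, hpZ, hpU⟩).trans
    (closure_minimal hZU I.support.isClosed)

/-- The vanishing ideal sheaf of a stratum is toroidal. -/
theorem IsSNC.isToroidal_vanishingIdeal [IsLocallyNoetherian X] {D : ι → X.IdealSheafData}
    (hD : IsSNC D) {Z : TopologicalSpace.Closeds X} (hZ : IsStratum D (Z : Set X)) :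
    IsToroidal D (Scheme.IdealSheafData.vanishingIdeal Z) := by
  classical
  intro p
  by_cases hpZ : p ∈ Z
  · obtain ⟨S, hS⟩ := hZ
    have hSD : ∀ i ∈ S, p ∈ (D i).support := Set.mem_iInter₂.mp (hS.prop.2 hpZ)
    obtain ⟨U, hp, n, x, c, ⟨_, hdim, hspan⟩, -, hDU⟩ := hD.exists_coordinates p
    set K : X.IdealSheafData := ⨆ i ∈ S, D i with hK
    have hKU : K.ideal U = Ideal.span (x '' ((S.attach.image fun i => c ⟨i.1, hSD i.1 i.2⟩ :
        Finset (Fin n)) : Set (Fin n))) := by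
      rw [hK, iSup_subtype', Scheme.IdealSheafData.ideal_iSup, iSup_apply]
      refine le_antisymm (iSup_le fun i => ?_) (Ideal.span_le.mpr ?_)
      · rw [hDU ⟨i.1, hSD i.1 i.2⟩, Ideal.span_singleton_le_iff_mem]
        exact Ideal.subset_span ⟨_, Finset.mem_image.mpr ⟨i, Finset.mem_attach _ _, rfl⟩, rfl⟩
      · rintro _ ⟨_, hj, rfl⟩
        obtain ⟨i, -, rfl⟩ := Finset.mem_image.mp hj
        refine Ideal.mem_iSup_of_mem i ?_
        rw [hDU ⟨i.1, hSD i.1 i.2⟩]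
        exact Ideal.mem_span_singleton_self _
    have hprime : ((K.ideal U).map (X.presheaf.germ U.1 p hp).hom).IsPrime := by
      rw [hKU, Ideal.map_span, ← Set.image_comp]
      exact IsLocalRing.isPrime_span_image hspan hdim.ge _
    rw [← coe_support_biSup] at hS
    have := IsLocallyNoetherian.component_noetherian U
    obtain ⟨a, hpa, hle⟩ := Scheme.exists_map_basicOpen_le U.2 hp (IsNoetherian.noetherian _)
      (Scheme.map_germ_vanishingIdeal_le hS U hp hpZ hprime)
    rw [Scheme.IdealSheafData.map_ideal_basicOpen, Scheme.IdealSheafData.map_ideal_basicOpen] at hle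
    -- Unit vectors as exponents present the sum of the `D i`, `i ∈ S`.
    refine ⟨X.affineBasicOpen a, hpa, (fun i => Pi.single i 1) '' (S : Set ι), ?_⟩
    have hA : (⨆ m ∈ (fun i => Pi.single i 1) '' (S : Set ι), monomialIdeal D m) = K := by
      rw [iSup_image]
      simp only [monomialIdeal_single, Finset.mem_coe, hK]
    rw [hA]
    exact le_antisymm hle
      (Scheme.IdealSheafData.le_support_iff_le_vanishingIdeal.mp hS.prop.2 _)
  · obtain ⟨_, ⟨U, hU, rfl⟩, hpU, hUZ⟩ :=
      X.isBasis_affineOpens.exists_subset_of_mem_open hpZ Z.isClosed.isOpen_compl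
    -- Off `Z` the ideal is the unit ideal, i.e. the monomial with exponent `0`.
    refine ⟨⟨U, hU⟩, hpU, {0}, ?_⟩
    rw [iSup_singleton, monomialIdeal_zero, Scheme.IdealSheafData.vanishingIdeal_ideal]
    have : hU.fromSpec ⁻¹' (Z : Set X) = ∅ := by
      refine Set.eq_empty_iff_forall_notMem.mpr fun y hy => hUZ ?_ hy
      have : hU.fromSpec y ∈ Set.range hU.fromSpec := ⟨y, rfl⟩
      rwa [hU.range_fromSpec] at this
    exact (congrArg PrimeSpectrum.vanishingIdeal this).trans PrimeSpectrum.vanishingIdeal_empty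

theorem isToroidallyResolved_iff_toroidalHull_eq_top [IsLocallyNoetherian X]
    {D : ι → X.IdealSheafData} (hD : IsSNC D) (J : X.IdealSheafData) :
    IsToroidallyResolved D J ↔ toroidalHull D J = ⊤ := by
  rw [toroidalHull, sInf_eq_top]
  constructor
  · rintro hJ I ⟨hI, hJI⟩
    rw [← Scheme.IdealSheafData.support_eq_bot_iff, eq_bot_iff]
    intro p hp
    obtain ⟨Z, hZ, hZI⟩ := hI.exists_isStratum_subset_support hp
    exact (hJ Z hZ (hZI.trans (Scheme.IdealSheafData.support_antitone hJI))).elim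
  · intro h Z hZ hZJ
    let Z' : TopologicalSpace.Closeds X := ⟨Z, isClosed_of_isStratum hZ⟩
    have hle : J ≤ Scheme.IdealSheafData.vanishingIdeal Z' :=
      Scheme.IdealSheafData.le_support_iff_le_vanishingIdeal.mp hZJ
    have htop := h _ ⟨hD.isToroidal_vanishingIdeal (Z := Z') hZ, hle⟩
    have hbot : Z' ≤ (⊤ : X.IdealSheafData).support :=
      Scheme.IdealSheafData.le_support_iff_le_vanishingIdeal.mpr htop.ge
    obtain ⟨S, hS⟩ := hZ
    obtain ⟨p, hp⟩ := hS.prop.1.1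
    rw [Scheme.IdealSheafData.support_top] at hbot
    exact Set.notMem_empty p (hbot hp)

end Toroidal

theorem mainTheorem9 {k : Type u} [Field k] {X : Scheme.{u}} (f : X ⟶ Spec (CommRingCat.of k))
    (hX : Toroidal.IsSmoothVariety f) {ι : Type*} [Fintype ι] (D : ι → X.IdealSheafData)
    (hD : Toroidal.IsSNC D) (J : X.IdealSheafData) :
    Toroidal.IsToroidallyResolved D J ↔ Toroidal.toroidalHull D J = ⊤ := by
  have := hX.smooth
  -- Noetherianity makes the ideal of a stratum finitely generated, so its stalk description spreads
  -- out.
  have := LocallyOfFiniteType.isLocallyNoetherian f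
  exact Toroidal.isToroidallyResolved_iff_toroidalHull_eq_top hD J
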